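/- Let $X$ be a (real or complex) Hilbert space, $U$ a Banach space over the same field, $B\in L(U,X)$ a bounded linear operator, and let $A:D(A)\subset X\to X$ be the infinitesimal generator of an exponentially stable $C_0$-semigroup $T=(T(t))_{t\ge 0}$ on $X$ (i.e. $\|T(t)\|\le Me^{-\omega t}$ for all $t\ge0$ with some $M$ and some $\omega>0$). Consider the system $$\dot x(t)=Ax(t)+Bu(t),\quad x(0)=x_0, \tag{1}$$ with mild solutions $x(t)=T(t)x_0+\int_0^tT(t-s)Bu(s)\,ds$. For $V:X\to[0,\infty)$ let $\dot V_u(x_0)=\limsup_{h\to0^+}\frac1h\big(V(x(h))-V(x_0)\big)\in[-\infty,\infty]$, where $x(\cdot)$ is the mild solution of (1). Definitions. $\mathcal K$ is the set of continuous strictly increasing $\mu:[0,\infty)\to[0,\infty)$ with $\mu(0)=0$, and $\mathcal K_\infty$ is the set of unbounded $\mu\in\mathcal K$. * A continuous $V:X\to[0,\infty)$ is an ISS Lyapunov function for (1) if there are $\alpha_2\in\mathcal K$, $\alpha_3,\sigma\in\mathcal K_\infty$ such that $0<V(x)\le\alpha_2(\|x\|)$ for $x\ne0$ and $\dot V_u(x)\le-\alpha_3(\|x\|)+\sigma\big(\limsup_{t\to0^+}\|u\|_{L^\infty(0,t)}\big)$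 for all $x\in X$ and all $u\in L^\infty_{loc}(0,\infty;U)$ (that is, $u|_{(0,t)}\in L^\infty(0,t;U)$ for every $t>0$). It is coercive if $\alpha_1(\|x\|)\le V(x)$ for all $x\in X$, for some $\alpha_1\in\mathcal K_\infty$. It is quadratic if $V(x)=\langle Px,x\rangle$ for all $x\in X$, for some self-adjoint $P\in L(X)$. A Lyapunov function for (1) with $B=0$ is an ISS Lyapunov function for (1) with $B$ replaced by $0$. * A continuous $V:X\to[0,\infty)$ is a coercive quadratic $L^2$-ISS Lyapunov function for (1) if there is $\alpha_2\in\mathcal K_\infty$ with $0<V(x)\le\alpha_2(\|x\|)$ for $x\neq0$, there are constants $a_3,a_4>0$ with $\dot V_u(x)\le-a_3\|x\|^2+a_4\|u(0)\|_U^2$ for all $x\in X$ and $u\in C([0,\infty),U)$, there is an injective $F\in L(X)$ with $V(x)=\|Fx\|^2$ for all $x\in X$, and there are $a_1,a_2>0$ with $a_1\|x\|^2\le V(x)\le a_2\|x\|^2$ for all $x\in X$. * An equivalent scalar product on $X$ is a scalar product $\langle\cdot,\cdot\rangle_{new}$ on $X$ whose norm $\|x\|_{new}=\sqrt{\langle x,x\rangle_{new}}$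 is equivalent to the norm of $X$. $A$ is dissipative for it if $\operatorname{Re}\langle Ax,x\rangle_{new}\le0$ for all $x\in D(A)$. Theorem. The following statements are equivalent. 1. There is a coercive quadratic $L^2$-ISS Lyapunov function for (1). 2. There is a coercive quadratic Lyapunov function for (1) with $B=0$. 3. There is an equivalent scalar product $\langle\cdot,\cdot\rangle_{new}$ such that $A$ is dissipative for it and $x\mapsto\langle x,x\rangle_{new}=\|x\|_{new}^2$ is a quadratic ISS Lyapunov function for (1). 4. There is an equivalent scalar product $\langle\cdot,\cdot\rangle_{new}$ on $X$ for which $A$ is dissipative. 5. $T$ is similar to a contraction semigroup: there is a boundedly invertible $S:X\to X$ with $\|ST(t)S^{-1}\|\le1$ for all $t\ge0$. 6. There are $F\in L(X)$ and $a>0$ such that $W(x)=\|Fx\|$ is a norm on $X$ equivalent to $\|\cdot\|$ and $\dot W(x)\le-a\,W(x)$ for all $x\in X$, where $\dot W(x)=\limsup_{h\to0^+}\frac1h\big(W(T(h)x)-W(x)\big)$ is the Dini derivative along (1) with $B=0$. -/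

import Mathlib

open Filter Topology MeasureTheory Set
open scoped NNReal ENNReal InnerProductSpace

/-- Class `𝒦`: continuous strictly increasing functions `[0,∞) → [0,∞)` vanishing at `0`. -/
def IsClassK (μ : ℝ≥0 → ℝ≥0) : Prop :=
  Continuous μ ∧ StrictMono μ ∧ μ 0 = 0

/-- Class `𝒦_∞`: unbounded functions of class `𝒦`. -/
def IsClassKInf (μ : ℝ≥0 → ℝ≥0) : Prop :=
  IsClassK μ ∧ Tendsto μ atTop atTop

/-- A strongly continuous semigroup of bounded linear operators. Only the values `T t` with `0 ≤ t`
are meaningful (and used below). -/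
structure C0Semigroup (𝕜 X : Type*) [RCLike 𝕜] [NormedAddCommGroup X] [NormedSpace 𝕜 X] where
  toFun : ℝ → X →L[𝕜] X
  map_zero' : toFun 0 = ContinuousLinearMap.id 𝕜 X
  map_add' : ∀ s t : ℝ, 0 ≤ s → 0 ≤ t → toFun (s + t) = (toFun s).comp (toFun t)
  tendsto_zero' : ∀ x : X, Tendsto (fun t : ℝ => toFun t x) (𝓝[>] 0) (𝓝 x)

section Banach

variable {𝕜 X U : Type*} [RCLike 𝕜] [NormedAddCommGroup X] [NormedSpace 𝕜 X]
  [NormedAddCommGroup U] [NormedSpace 𝕜 U]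

instance : CoeFun (C0Semigroup 𝕜 X) (fun _ => ℝ → X →L[𝕜] X) := ⟨C0Semigroup.toFun⟩

/-- `A` is the infinitesimal generator of `T`: `x ∈ D(A)` and `A x = y` if and only if
`(T(h) x - x) / h → y` as `h → 0⁺`. -/
def IsGenerator (A : X →ₗ.[𝕜] X) (T : C0Semigroup 𝕜 X) : Prop :=
  ∀ x y : X, (∃ hx : x ∈ A.domain, A ⟨x, hx⟩ = y) ↔
    Tendsto (fun h : ℝ => ((h⁻¹ : ℝ) : 𝕜) • (T h x - x)) (𝓝[>] 0) (𝓝 y)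

/-- `‖T(t)‖ ≤ M e^{-ωt}` for all `t ≥ 0`, for some `M` and some `ω > 0`. -/
def IsExpStable (T : C0Semigroup 𝕜 X) : Prop :=
  ∃ M ω : ℝ, 0 < ω ∧ ∀ t : ℝ, 0 ≤ t → ‖T t‖ ≤ M * Real.exp (-ω * t)

/-- The mild solution `t ↦ T(t) x₀ + ∫₀ᵗ T(t-s) B u(s) ds` of `x' = A x + B u`, `x(0) = x₀`, with
the Bochner integral of `X`-valued functions (`X` viewed as a real normed space). -/
noncomputable def mildSolution (T : C0Semigroup 𝕜 X) (B : U →L[𝕜] X) (x₀ : X) (u : ℝ → U)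
    (t : ℝ) : X :=
  letI : NormedSpace ℝ X := NormedSpace.restrictScalars ℝ 𝕜 X
  T t x₀ + ∫ s in (0 : ℝ)..t, T (t - s) (B (u s))

/-- The right-hand upper Dini derivative of `V ∘ φ` at `0`, as an extended real number. -/
noncomputable def diniDeriv (V : X → ℝ) (φ : ℝ → X) : EReal :=
  limsup (fun h : ℝ => (((V (φ h) - V (φ 0)) / h : ℝ) : EReal)) (𝓝[>] 0)

/-- The space `L^∞_loc(0,∞;U)`: the restriction of `u` to every `(0,t)` belongs to `L^∞`. -/
def IsLocEssBounded (u : ℝ → U) : Prop :=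
  ∀ t : ℝ, 0 < t → MemLp u ∞ (volume.restrict (Ioo 0 t))

/-- `limsup_{t → 0⁺} ‖u‖_{L^∞(0,t)}`, which is finite for `u ∈ L^∞_loc(0,∞;U)`. -/
noncomputable def initialEssSup (u : ℝ → U) : ℝ≥0 :=
  (limsup (fun t : ℝ => eLpNorm u ∞ (volume.restrict (Ioo 0 t))) (𝓝[>] 0)).toNNReal

/-- A (possibly non-coercive) ISS Lyapunov function for `x' = A x + B u`. -/
def IsISSLyapunov (T : C0Semigroup 𝕜 X) (B : U →L[𝕜] X) (V : X → ℝ) : Prop :=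
  Continuous V ∧ (∀ x, 0 ≤ V x) ∧
  ∃ α₂ α₃ σ : ℝ≥0 → ℝ≥0, IsClassK α₂ ∧ IsClassKInf α₃ ∧ IsClassKInf σ ∧
    (∀ x, x ≠ 0 → 0 < V x ∧ V x ≤ α₂ ‖x‖₊) ∧
    ∀ (x : X) (u : ℝ → U), IsLocEssBounded u →
      diniDeriv V (mildSolution T B x u) ≤
        ((-(α₃ ‖x‖₊ : ℝ) + (σ (initialEssSup u) : ℝ) : ℝ) : EReal)

/-- Coercivity: `α₁(‖x‖) ≤ V(x)` for some `α₁` of class `𝒦_∞`. -/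
def HasCoerciveLowerBound (V : X → ℝ) : Prop :=
  ∃ α₁ : ℝ≥0 → ℝ≥0, IsClassKInf α₁ ∧ ∀ x, (α₁ ‖x‖₊ : ℝ) ≤ V x

/-- A (possibly non-coercive) `L^p`-ISS Lyapunov function for `x' = A x + B u`, where the inputs
are continuous on `[0,∞)`. -/
def IsLpISSLyapunov (p : ℝ) (T : C0Semigroup 𝕜 X) (B : U →L[𝕜] X) (V : X → ℝ) : Prop :=
  Continuous V ∧ (∀ x, 0 ≤ V x) ∧
  (∃ α₂ : ℝ≥0 → ℝ≥0, IsClassKInf α₂ ∧ ∀ x, x ≠ 0 → 0 < V x ∧ V x ≤ α₂ ‖x‖₊) ∧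
  ∃ a₃ a₄ : ℝ, 0 < a₃ ∧ 0 < a₄ ∧
    ∀ (x : X) (u : ℝ → U), ContinuousOn u (Ici 0) →
      diniDeriv V (mildSolution T B x u) ≤ ((-a₃ * ‖x‖ ^ 2 + a₄ * ‖u 0‖ ^ p : ℝ) : EReal)

/-- A coercive quadratic `L^p`-ISS Lyapunov function: `V(x) = ‖F x‖²` with `F ∈ L(X)` injective,
and `a₁ ‖x‖² ≤ V(x) ≤ a₂ ‖x‖²` with `a₁, a₂ > 0`. -/
def IsCoerciveQuadraticLpISSLyapunov (p : ℝ) (T : C0Semigroup 𝕜 X) (B : U →L[𝕜] X)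
    (V : X → ℝ) : Prop :=
  IsLpISSLyapunov p T B V ∧
  (∃ F : X →L[𝕜] X, Function.Injective F ∧ ∀ x, V x = ‖F x‖ ^ 2) ∧
  ∃ a₁ a₂ : ℝ, 0 < a₁ ∧ 0 < a₂ ∧ ∀ x, a₁ * ‖x‖ ^ 2 ≤ V x ∧ V x ≤ a₂ * ‖x‖ ^ 2

/-- `N` is comparable with the given norm of `X`. -/
def IsEquivalentToNorm (N : X → ℝ) : Prop :=
  ∃ c C : ℝ, 0 < c ∧ 0 < C ∧ ∀ x, c * ‖x‖ ≤ N x ∧ N x ≤ C * ‖x‖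

/-- The squared norm `x ↦ ⟨x, x⟩_S` of a scalar product `S` on the vector space `X`. -/
noncomputable def scalarNormSq (S : InnerProductSpace.Core 𝕜 X) (x : X) : ℝ :=
  RCLike.re (S.inner x x)

/-- The scalar product `S` on (the vector space) `X` is equivalent to the given one: its norm
`x ↦ √⟨x, x⟩_S` is equivalent to the norm of `X`. -/
def IsEquivalentScalarProduct (S : InnerProductSpace.Core 𝕜 X) : Prop :=
  IsEquivalentToNorm (fun x : X => √(scalarNormSq S x))

/-- `A` is dissipative for the scalar product `S`. -/
def IsDissipative (A : X →ₗ.[𝕜] X) (S : InnerProductSpace.Core 𝕜 X) : Prop :=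
  ∀ x : A.domain, RCLike.re (S.inner (A x) (x : X)) ≤ 0

/-- `(S T(t) S⁻¹)_{t ≥ 0}` is a contraction semigroup for some boundedly invertible `S : X → X`. -/
def IsSimilarToContraction (T : C0Semigroup 𝕜 X) : Prop :=
  ∃ S : X ≃L[𝕜] X, ∀ t : ℝ, 0 ≤ t →
    ‖(S : X →L[𝕜] X).comp ((T t).comp (S.symm : X →L[𝕜] X))‖ ≤ 1

end Banach

/-- `V(x) = ⟨P x, x⟩` for some bounded self-adjoint operator `P`. -/
def IsQuadratic (𝕜 : Type*) {X : Type*} [RCLike 𝕜] [NormedAddCommGroup X]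
    [InnerProductSpace 𝕜 X] [CompleteSpace X] (V : X → ℝ) : Prop :=
  ∃ P : X →L[𝕜] X, IsSelfAdjoint P ∧ ∀ x, ((V x : ℝ) : 𝕜) = ⟪P x, x⟫_𝕜

/-! Statement 5 is the hub. If `‖F (T t x)‖ ≤ ‖F x‖` with `F` invertible, the form `⟨F x, F y⟩ +
∫₀^∞ ⟨T t x, T t y⟩ dt` is an equivalent scalar product: exponential stability bounds the integral,
and the first term supplies the coercivity that the integral alone may lack. Replacing `x` by `T h
x` does not increase the first term and removes exactly `∫₀ʰ ‖T t x‖² dt` from the second. Writing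
the new norm as `‖G x‖` (`exists_normSq_decay`), this strict decay gives 1, 3 and 6: a bounded `B`
moves the trajectory by only `O(h)`, and Young's inequality absorbs the cross term into half of the
decay.

Conversely, a coercive quadratic `V` equals `‖F x‖²` with `F` invertible, by a square root of its
operator. Along an orbit starting in `D(A)` its Dini derivative is the true right derivative `2 Re
⟨F A x, F x⟩`, so nonpositivity is dissipativity; statement 6 reaches 4 in the same way. From 4, `‖F
(T t x)‖²` is nonincreasing for `x ∈ D(A)`, and density of `D(A)` gives 5
(`norm_apply_semigroup_le_of_dissipative`). An equivalent scalar product is always a pull-back `⟨F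
x, F y⟩` (`IsEquivalentScalarProduct.exists_equiv`), which lets all forms of the argument work with
operators `F`. -/

/-! ### Square roots of coercive operators and equivalent scalar products -/

section SquareRoot

variable {𝕜 X : Type*} [RCLike 𝕜] [NormedAddCommGroup X] [InnerProductSpace 𝕜 X] [CompleteSpace X]

/-- A self-adjoint operator `1 - B` with `‖B‖ < 1` has a self-adjoint invertible square root. -/
theorem exists_selfAdjoint_isUnit_mul_self_eq_one_sub (B : X →L[𝕜] X) (hB : IsSelfAdjoint B)
    (hB1 : ‖B‖ < 1) :
    ∃ R : X →L[𝕜] X, IsSelfAdjoint R ∧ IsUnit R ∧ R * R = 1 - B := by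
  -- The equation `(1 - Y)² = 1 - B` is the fixed-point equation `Y = (B + Y²) / 2`. Since `‖B‖ = 2r
  -- - 1` and `r < 1`, this map preserves the self-adjoint part of the ball of radius `r` and
  -- contracts it with ratio `r`.
  set r : ℝ := (1 + ‖B‖) / 2 with hr
  have hβ := norm_nonneg B
  have hr0 : 0 ≤ r := by positivity
  have hr1 : r < 1 := by linarith
  let f : (X →L[𝕜] X) → (X →L[𝕜] X) := fun Y => (2⁻¹ : 𝕜) • (B + Y * Y)
  let s : Set (X →L[𝕜] X) := {Y | IsSelfAdjoint Y} ∩ Metric.closedBall 0 r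
  have h2 : ‖(2⁻¹ : 𝕜)‖ = 2⁻¹ := by simp
  have h2' : IsSelfAdjoint (2⁻¹ : 𝕜) := by simp [isSelfAdjoint_iff]
  have hs : IsComplete s :=
    ((isClosed_eq continuous_star continuous_id).inter Metric.isClosed_closedBall).isComplete
  have hmaps : MapsTo f s s := by
    rintro Y ⟨hY, hYr⟩
    rw [mem_closedBall_zero_iff] at hYr
    have hYY : IsSelfAdjoint (Y * Y) := by
      have hY' : star Y = Y := hY
      simp [isSelfAdjoint_iff, star_mul, hY']
    refine ⟨h2'.smul (hB.add hYY), ?_⟩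
    rw [mem_closedBall_zero_iff, norm_smul, h2]
    have h3 := norm_add_le B (Y * Y)
    have h4 := norm_mul_le Y Y
    have h5 : ‖Y‖ * ‖Y‖ ≤ r * r := by gcongr
    nlinarith
  have hlip : ContractingWith ⟨r, hr0⟩ (hmaps.restrict f s s) := by
    refine ⟨by exact_mod_cast hr1, LipschitzWith.of_dist_le_mul ?_⟩
    rintro ⟨Y, hY, hYr⟩ ⟨Z, hZ, hZr⟩
    rw [mem_closedBall_zero_iff] at hYr hZr
    change dist (f Y) (f Z) ≤ r * dist Y Z
    rw [dist_eq_norm, dist_eq_norm]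
    have h3 : f Y - f Z = (2⁻¹ : 𝕜) • (Y * (Y - Z) + (Y - Z) * Z) := by
      simp only [f, ← smul_sub]; congr 1; noncomm_ring
    rw [h3, norm_smul, h2]
    have h4 := norm_add_le (Y * (Y - Z)) ((Y - Z) * Z)
    have h5 := norm_mul_le Y (Y - Z)
    have h6 := norm_mul_le (Y - Z) Z
    have h7 := norm_nonneg (Y - Z)
    nlinarith
  have h0 : (0 : X →L[𝕜] X) ∈ s := ⟨IsSelfAdjoint.zero _, by simpa using hr0⟩
  obtain ⟨Y, ⟨hY, hYr⟩, hfix, -⟩ := hlip.exists_fixedPoint' hs hmaps h0 (edist_ne_top _ _)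
  rw [mem_closedBall_zero_iff] at hYr
  refine ⟨1 - Y, (IsSelfAdjoint.one _).sub hY, isUnit_one_sub_of_norm_lt_one (hYr.trans_lt hr1), ?_⟩
  have h3 : B + Y * Y = Y + Y := by
    have h4 : (2 : 𝕜) • f Y = (2 : 𝕜) • Y := congrArg _ hfix
    simpa [f, smul_smul, two_smul] using h4
  have h4 : (1 - Y) * (1 - Y) = 1 - (Y + Y) + Y * Y := by noncomm_ring
  rw [h4, ← h3]; abel

/-- A coercive self-adjoint operator `P` factors as `F* F` with `F` boundedly invertible. -/
theorem exists_equiv_inner_eq_of_coercive (P : X →L[𝕜] X) (hP : IsSelfAdjoint P) {c : ℝ}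
    (hc : 0 < c) (hPc : ∀ x, c * ‖x‖ ^ 2 ≤ RCLike.re ⟪P x, x⟫_𝕜) :
    ∃ F : X ≃L[𝕜] X, ∀ x y, ⟪P x, y⟫_𝕜 = ⟪F x, F y⟫_𝕜 := by
  -- With `‖P‖² < l c`, the quadratic term in `‖x - l⁻¹ P x‖²` cancels at most half of the linear
  -- one, leaving `‖1 - l⁻¹ P‖² ≤ 1 - c / l` when `X` is nontrivial.
  set l : ℝ := ‖P‖ ^ 2 / c + 1 with hl
  have hl0 : 0 < l := by positivity
  have hlP : ‖P‖ ^ 2 < l * c := by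
    have : ‖P‖ ^ 2 / c * c = ‖P‖ ^ 2 := by field_simp
    rw [hl, add_mul, this]; linarith
  have hlK : (l : 𝕜) ≠ 0 := by exact_mod_cast hl0.ne'
  let B : X →L[𝕜] X := 1 - (l : 𝕜)⁻¹ • P
  have hsl : IsSelfAdjoint ((l : 𝕜)⁻¹) := by simp [isSelfAdjoint_iff]
  have hB : IsSelfAdjoint B := (IsSelfAdjoint.one _).sub (hsl.smul hP)
  -- The maximum matters only for trivial `X`, where `c` is arbitrary and `1 - c / l` may be
  -- negative.
  have hq : 0 ≤ max 0 (1 - c / l) := le_max_left _ _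
  have hcl : 0 < c / l := by positivity
  have hBn : ‖B‖ ≤ √(max 0 (1 - c / l)) := by
    refine ContinuousLinearMap.opNorm_le_bound _ (Real.sqrt_nonneg _) fun x => ?_
    refine le_of_sq_le_sq ?_ (by positivity)
    rw [mul_pow, Real.sq_sqrt hq]
    have h1 : ‖B x‖ ^ 2 = ‖x‖ ^ 2 - 2 * (l⁻¹ * RCLike.re ⟪P x, x⟫_𝕜) + (l⁻¹ * ‖P x‖) ^ 2 := by
      have h2 : B x = x - ((l⁻¹ : ℝ) : 𝕜) • P x := by simp [B]
      rw [h2, norm_sub_sq (𝕜 := 𝕜), inner_smul_right, RCLike.re_ofReal_mul, norm_smul,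
        RCLike.norm_ofReal, abs_of_pos (inv_pos.2 hl0), inner_re_symm]
    have h3 : ‖P x‖ ^ 2 ≤ l * c * ‖x‖ ^ 2 := by
      calc ‖P x‖ ^ 2 ≤ (‖P‖ * ‖x‖) ^ 2 := by gcongr; exact P.le_opNorm x
        _ = ‖P‖ ^ 2 * ‖x‖ ^ 2 := by ring
        _ ≤ _ := by gcongr
    have h4 : (l⁻¹ * ‖P x‖) ^ 2 ≤ c / l * ‖x‖ ^ 2 := by
      calc (l⁻¹ * ‖P x‖) ^ 2 = l⁻¹ ^ 2 * ‖P x‖ ^ 2 := by ring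
        _ ≤ l⁻¹ ^ 2 * (l * c * ‖x‖ ^ 2) := by gcongr
        _ = _ := by field_simp
    have h5 : c / l * ‖x‖ ^ 2 ≤ l⁻¹ * RCLike.re ⟪P x, x⟫_𝕜 := by
      calc c / l * ‖x‖ ^ 2 = l⁻¹ * (c * ‖x‖ ^ 2) := by field_simp
        _ ≤ _ := by gcongr; exact hPc x
    have h6 : (1 - c / l) * ‖x‖ ^ 2 ≤ max 0 (1 - c / l) * ‖x‖ ^ 2 := by
      gcongr; exact le_max_right _ _
    linarith
  have hB1 : ‖B‖ < 1 := hBn.trans_lt (by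
    rw [Real.sqrt_lt' one_pos]; simp only [one_pow, max_lt_iff]; constructor <;> linarith)
  obtain ⟨R, hR, hRu, hRR⟩ := exists_selfAdjoint_isUnit_mul_self_eq_one_sub B hB hB1
  have hsq : ((√l : ℝ) : 𝕜) ≠ 0 := by exact_mod_cast (Real.sqrt_pos.2 hl0).ne'
  -- The factor is `F = √l R`, since `l R² = l (1 - B) = P`.
  have hu : IsUnit (algebraMap 𝕜 (X →L[𝕜] X) (√l : ℝ) * R) :=
    ((IsUnit.mk0 _ hsq).map (algebraMap 𝕜 (X →L[𝕜] X))).mul hRu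
  obtain ⟨u, hu⟩ := hu
  refine ⟨ContinuousLinearEquiv.unitsEquiv 𝕜 X u, fun x y => ?_⟩
  have h1 : ∀ z, ContinuousLinearEquiv.unitsEquiv 𝕜 X u z = ((√l : ℝ) : 𝕜) • R z := fun z => by
    rw [ContinuousLinearEquiv.unitsEquiv_apply, hu]; rfl
  have h2 : R (R x) = (l : 𝕜)⁻¹ • P x := by
    change (R * R) x = _
    rw [hRR]; simp [B]
  rw [h1, h1, inner_smul_left, inner_smul_right, ← ContinuousLinearMap.adjoint_inner_left,
    hR.adjoint_eq, h2, inner_smul_left, RCLike.conj_ofReal, map_inv₀, RCLike.conj_ofReal]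
  rw [← mul_assoc, ← mul_assoc, ← RCLike.ofReal_mul, Real.mul_self_sqrt hl0.le,
    mul_inv_cancel₀ hlK, one_mul]

/-- A scalar product equivalent to the given one is the pull-back of the given one under a
boundedly invertible operator. -/
theorem IsEquivalentScalarProduct.exists_equiv {S : InnerProductSpace.Core 𝕜 X}
    (hS : IsEquivalentScalarProduct S) :
    ∃ F : X ≃L[𝕜] X, ∀ x y, S.inner x y = ⟪F x, F y⟫_𝕜 := by
  obtain ⟨c, C, hc, hC, h⟩ := hS
  -- Cauchy–Schwarz for `S` makes it a bounded sesquilinear form, hence represented by an operator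
  -- `P`; the lower norm bound is then coercivity of `P`.
  have hCS : ∀ x y, ‖S.inner x y‖ ≤ C ^ 2 * ‖x‖ * ‖y‖ := fun x y => by
    have h1 := @InnerProductSpace.Core.inner_mul_inner_self_le 𝕜 X _ _ _ S.toCore x y
    have h2 : ‖S.inner y x‖ = ‖S.inner x y‖ := by rw [← S.conj_inner_symm x y, RCLike.norm_conj]
    have hq : ∀ z, scalarNormSq S z ≤ (C * ‖z‖) ^ 2 := fun z =>
      (Real.sqrt_le_left (by positivity)).1 (h z).2
    have h3 : ‖S.inner x y‖ * ‖S.inner y x‖ ≤ scalarNormSq S x * scalarNormSq S y := h1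
    rw [h2] at h3
    refine abs_le_of_sq_le_sq' ?_ (by positivity) |>.2
    calc ‖S.inner x y‖ ^ 2 = ‖S.inner x y‖ * ‖S.inner x y‖ := sq _
      _ ≤ _ := h3
      _ ≤ (C * ‖x‖) ^ 2 * (C * ‖y‖) ^ 2 :=
        mul_le_mul (hq x) (hq y) (S.re_inner_nonneg y) (by positivity)
      _ = _ := by ring
  have hadd : ∀ x y z, S.inner x (y + z) = S.inner x y + S.inner x z := fun x y z => by
    rw [← S.conj_inner_symm, S.add_left, map_add, S.conj_inner_symm, S.conj_inner_symm]
  have hsmul : ∀ (a : 𝕜) x y, S.inner x (a • y) = a * S.inner x y := fun a x y => by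
    rw [← S.conj_inner_symm, S.smul_left, map_mul, S.conj_inner_symm, RCLike.conj_conj]
  let b : X →L⋆[𝕜] X →L[𝕜] 𝕜 := LinearMap.mkContinuous₂
    (LinearMap.mk₂'ₛₗ (starRingEnd 𝕜) (RingHom.id 𝕜) S.inner S.add_left
      (fun a x y => S.smul_left x y a) hadd hsmul) (C ^ 2) hCS
  let P : X →L[𝕜] X := InnerProductSpace.continuousLinearMapOfBilin b
  have hP : ∀ x y, ⟪P x, y⟫_𝕜 = S.inner x y := fun x y =>
    InnerProductSpace.continuousLinearMapOfBilin_apply b x y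
  have hsa : IsSelfAdjoint P := by
    rw [ContinuousLinearMap.isSelfAdjoint_iff_isSymmetric]
    intro x y
    change ⟪P x, y⟫_𝕜 = ⟪x, P y⟫_𝕜
    rw [← inner_conj_symm x, hP, hP, S.conj_inner_symm]
  obtain ⟨F, hF⟩ := exists_equiv_inner_eq_of_coercive P hsa (c := c ^ 2) (by positivity) fun x => by
    rw [hP, ← mul_pow]
    exact (Real.le_sqrt (by positivity) (S.re_inner_nonneg x)).1 (h x).1
  exact ⟨F, fun x y => by rw [← hP, hF]⟩

end SquareRoot

/-! ### Orbits of the semigroup and density of the generator's domain -/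

theorem tendsto_inv_mul_integral_nhdsGT {φ : ℝ → ℝ} (hφ : ContinuousOn φ (Ici 0)) :
    Tendsto (fun h : ℝ => h⁻¹ * ∫ t in (0 : ℝ)..h, φ t) (𝓝[>] 0) (𝓝 (φ 0)) := by
  have h1 : HasDerivWithinAt (fun h => ∫ t in (0 : ℝ)..h, φ t) (φ 0) (Ici 0) 0 :=
    intervalIntegral.integral_hasDerivWithinAt_right (t := Ioi 0) (by simp)
      ((hφ.mono Ioi_subset_Ici_self).stronglyMeasurableAtFilter_nhdsWithin measurableSet_Ioi 0)
      ((hφ 0 self_mem_Ici).mono Ioi_subset_Ici_self)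
  have h2 := (hasDerivWithinAt_iff_tendsto_slope' self_notMem_Ioi).1
    (h1.mono Ioi_subset_Ici_self)
  simpa [slope_fun_def] using h2

section Semigroup

variable {𝕜 X : Type*} [RCLike 𝕜] [NormedAddCommGroup X] [NormedSpace 𝕜 X]

theorem IsExpStable.exists_bound {T : C0Semigroup 𝕜 X} (hT : IsExpStable T) :
    ∃ M ω : ℝ, 0 < M ∧ 0 < ω ∧ ∀ t : ℝ, 0 ≤ t → ‖T t‖ ≤ M * Real.exp (-ω * t) := by
  obtain ⟨M, ω, hω, h⟩ := hT
  refine ⟨max M 1, ω, by positivity, hω, fun t ht => (h t ht).trans ?_⟩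
  gcongr
  exact le_max_left _ _

theorem IsExpStable.exists_uniform_bound {T : C0Semigroup 𝕜 X} (hT : IsExpStable T) :
    ∃ M : ℝ, 0 < M ∧ ∀ t : ℝ, 0 ≤ t → ‖T t‖ ≤ M := by
  obtain ⟨M, ω, hM, hω, h⟩ := hT.exists_bound
  refine ⟨M, hM, fun t ht => (h t ht).trans (mul_le_of_le_one_right hM.le ?_)⟩
  rw [Real.exp_le_one_iff]; nlinarith

namespace C0Semigroup

variable (T : C0Semigroup 𝕜 X)

@[simp] theorem zero_apply (x : X) : T 0 x = x := by rw [T.map_zero']; rfl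

theorem add_apply {s t : ℝ} (hs : 0 ≤ s) (ht : 0 ≤ t) (x : X) : T (s + t) x = T s (T t x) := by
  rw [T.map_add' s t hs ht]; rfl

theorem tendsto_nhdsGE_zero (x : X) : Tendsto (fun t : ℝ => T t x) (𝓝[≥] 0) (𝓝 x) := by
  rw [← Ioi_insert, nhdsWithin_insert, tendsto_sup]
  refine ⟨?_, T.tendsto_zero' x⟩
  simpa using tendsto_pure_nhds (fun t : ℝ => T t x) 0

variable {T}

/-- For `t ≤ s`, factor `T s x - T t x = T t (T (s - t) x - x)`. This reduces two-sided continuity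
of orbits to right continuity at `0`. -/
theorem norm_sub_apply_le {M : ℝ} (hM : ∀ t : ℝ, 0 ≤ t → ‖T t‖ ≤ M) {s t : ℝ} (hs : 0 ≤ s)
    (ht : 0 ≤ t) (x : X) : ‖T s x - T t x‖ ≤ M * ‖T |s - t| x - x‖ := by
  wlog hst : t ≤ s generalizing s t
  · rw [norm_sub_rev, abs_sub_comm]
    exact this ht hs (le_of_not_ge hst)
  have h1 : T s x - T t x = T t (T (s - t) x - x) := by
    rw [map_sub, ← T.add_apply ht (sub_nonneg.2 hst), add_sub_cancel]
  rw [h1, abs_of_nonneg (sub_nonneg.2 hst)]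
  exact (T t).le_of_opNorm_le (hM t ht) _

theorem continuousOn_orbit (hT : IsExpStable T) (x : X) :
    ContinuousOn (fun t : ℝ => T t x) (Ici 0) := by
  obtain ⟨M, -, hM⟩ := hT.exists_uniform_bound
  intro t ht
  have h1 : Tendsto (fun s : ℝ => |s - t|) (𝓝[Ici 0] t) (𝓝[≥] 0) := by
    refine tendsto_nhdsWithin_iff.2 ⟨?_, Eventually.of_forall fun s => mem_Ici.2 (abs_nonneg _)⟩
    have : Continuous fun s : ℝ => |s - t| := by fun_prop
    simpa using (this.tendsto t).mono_left nhdsWithin_le_nhds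
  have h2 := ((T.tendsto_nhdsGE_zero x).comp h1).sub_const x
  rw [sub_self] at h2
  have h3 := h2.norm.const_mul M
  rw [norm_zero, mul_zero] at h3
  refine tendsto_iff_norm_sub_tendsto_zero.2 (squeeze_zero' (Eventually.of_forall fun _ =>
    norm_nonneg _) ?_ h3)
  filter_upwards [self_mem_nhdsWithin] with s hs
  exact norm_sub_apply_le hM hs ht x

end C0Semigroup

variable {A : X →ₗ.[𝕜] X} {T : C0Semigroup 𝕜 X}

theorem IsGenerator.tendsto (hA : IsGenerator A T) (x : A.domain) :
    Tendsto (fun h : ℝ => ((h⁻¹ : ℝ) : 𝕜) • (T h x - x)) (𝓝[>] 0) (𝓝 (A x)) :=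
  (hA x (A x)).1 ⟨x.2, rfl⟩

theorem IsGenerator.apply_mem (hA : IsGenerator A T) (x : A.domain) {t : ℝ} (ht : 0 ≤ t) :
    ∃ h : T t x ∈ A.domain, A ⟨T t x, h⟩ = T t (A x) := by
  refine (hA _ _).2 ((((T t).continuous.tendsto _).comp (hA.tendsto x)).congr' ?_)
  filter_upwards [self_mem_nhdsWithin] with h hh
  have hh' : 0 ≤ h := le_of_lt hh
  rw [Function.comp_apply, map_smul, map_sub, ← T.add_apply ht hh', add_comm,
    T.add_apply hh' ht]

/-- The integrals `G h = ∫₀ʰ T s x ds` lie in the domain, with `A (G h) = T h x - x`, and `h⁻¹ G h →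
x`. -/
theorem IsGenerator.dense_domain [CompleteSpace X] (hA : IsGenerator A T) (hT : IsExpStable T) :
    Dense (A.domain : Set X) := by
  let : NormedSpace ℝ X := NormedSpace.restrictScalars ℝ 𝕜 X
  have hsm : ∀ (r : ℝ) (z : X), (r : 𝕜) • z = r • z := fun r z => by
    rw [← RCLike.algebraMap_eq_ofReal]; rfl
  intro x
  -- Extending the orbit by `x` to negative times makes the integrand continuous on all of `ℝ`, so
  -- that the two-sided fundamental theorem of calculus applies at `0`.
  let g : ℝ → X := fun s => T (max s 0) x
  have hg : Continuous g := by
    have h1 : Continuous fun s : ℝ => max s 0 := by fun_prop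
    exact (C0Semigroup.continuousOn_orbit hT x).comp_continuous h1 fun s => mem_Ici.2 (le_max_right _ _)
  have hg0 : g 0 = x := by simp [g]
  let G : ℝ → X := fun t => ∫ s in (0 : ℝ)..t, g s
  have hG : ∀ t, HasDerivAt G (g t) t := fun t => (hg.integral_hasStrictDerivAt 0 t).hasDerivAt
  have hG0 : G 0 = 0 := by simp [G]
  have hlim : ∀ t, Tendsto (fun k : ℝ => k⁻¹ • (G (t + k) - G t)) (𝓝[>] 0) (𝓝 (g t)) := fun t =>
    (hG t).tendsto_slope_zero_right
  have hmem : ∀ h : ℝ, 0 ≤ h → G h ∈ A.domain := by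
    intro h hh
    have h1 := (hlim h).sub (hlim 0)
    refine ((hA (G h) (g h - g 0)).2 (h1.congr' ?_)).1
    filter_upwards [self_mem_nhdsWithin] with k hk
    have hk' : (0 : ℝ) ≤ k := le_of_lt hk
    -- Shifting the integration window turns the difference quotient of `G h` into the difference of
    -- the orbit's averages over `[h, h + k]` and `[0, k]`.
    have h2 : T k (G h) = G (h + k) - G k := by
      have h3 : ∫ s in (0 : ℝ)..h, T k (g s) = T k (G h) :=
        (T k).intervalIntegral_comp_comm (hg.intervalIntegrable _ _)
      have h4 : ∫ s in (0 : ℝ)..h, T k (g s) = ∫ s in (0 : ℝ)..h, g (s + k) := by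
        refine intervalIntegral.integral_congr fun s hs => ?_
        rw [uIcc_of_le hh] at hs
        have h5 : 0 ≤ s + k := add_nonneg hs.1 hk'
        simp only [g]
        rw [max_eq_left hs.1, max_eq_left h5, add_comm s k, T.add_apply hk' hs.1]
      rw [← h3, h4, intervalIntegral.integral_comp_add_right, zero_add]
      exact (intervalIntegral.integral_interval_sub_left (hg.intervalIntegrable _ _)
        (hg.intervalIntegrable _ _)).symm
    rw [hsm, h2, ← smul_sub, hG0, zero_add]
    congr 1; abel
  have h1 := hlim 0
  simp only [zero_add, hG0, sub_zero, hg0] at h1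
  refine mem_closure_of_tendsto h1 ?_
  filter_upwards [self_mem_nhdsWithin] with k hk
  rw [← hsm]
  exact A.domain.smul_mem _ (hmem k (le_of_lt hk))

end Semigroup

/-! ### Dissipativity implies contractivity -/

section Hilbert

variable {𝕜 X : Type*} [RCLike 𝕜] [NormedAddCommGroup X] [InnerProductSpace 𝕜 X]

/-- Use `‖a‖² - ‖b‖² = Re ⟨a - b, a + b⟩` with `a = F (T h x)` and `b = F x`: the first slot divided
by `h` tends to `F y`, the second to `2 F x`. -/
theorem tendsto_normSq_quotient {T : C0Semigroup 𝕜 X} (F : X →L[𝕜] X) {x y : X}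
    (h : Tendsto (fun h : ℝ => ((h⁻¹ : ℝ) : 𝕜) • (T h x - x)) (𝓝[>] 0) (𝓝 y)) :
    Tendsto (fun h : ℝ => (‖F (T h x)‖ ^ 2 - ‖F x‖ ^ 2) / h) (𝓝[>] 0)
      (𝓝 (2 * RCLike.re ⟪F y, F x⟫_𝕜)) := by
  have h1 := (F.continuous.tendsto y).comp h
  have h2 := ((F.continuous.tendsto x).comp (T.tendsto_zero' x)).add_const (F x)
  have h3 := (RCLike.continuous_re.tendsto _).comp (h1.inner (𝕜 := 𝕜) h2)
  have h4 : RCLike.re ⟪F y, F x + F x⟫_𝕜 = 2 * RCLike.re ⟪F y, F x⟫_𝕜 := by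
    rw [inner_add_right, map_add]; ring
  rw [h4] at h3
  refine h3.congr fun h => ?_
  simp only [Function.comp_apply, map_smul, map_sub]
  rw [inner_smul_left, RCLike.conj_ofReal, RCLike.re_ofReal_mul, inner_sub_left, inner_add_right,
    inner_add_right, map_sub, map_add, map_add, inner_self_eq_norm_sq, inner_self_eq_norm_sq,
    inner_re_symm (F x) (F (T h x))]
  ring

variable {A : X →ₗ.[𝕜] X} {T : C0Semigroup 𝕜 X}

/-- Orbits starting in the domain stay there, so `s ↦ ‖F (T s x)‖²` has a nonpositive right
derivative everywhere. A right derivative suffices for comparison with a constant, and the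
inequality passes to the closure of the domain. -/
theorem norm_apply_semigroup_le_of_dissipative [CompleteSpace X] (hA : IsGenerator A T)
    (hT : IsExpStable T) (F : X →L[𝕜] X)
    (hF : ∀ x : A.domain, RCLike.re ⟪F (A x), F x⟫_𝕜 ≤ 0) {t : ℝ} (ht : 0 ≤ t) (x : X) :
    ‖F (T t x)‖ ≤ ‖F x‖ := by
  have hcl : IsClosed {x : X | ‖F (T t x)‖ ≤ ‖F x‖} :=
    isClosed_le (by fun_prop) (by fun_prop)
  refine closure_minimal ?_ hcl (hA.dense_domain hT x)
  intro x hx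
  lift x to A.domain using hx
  have hcont : ContinuousOn (fun s => ‖F (T s x)‖ ^ 2) (Icc 0 t) :=
    ((F.continuous.comp_continuousOn (C0Semigroup.continuousOn_orbit hT x)).norm.pow 2).mono
      Icc_subset_Ici_self
  have hderiv : ∀ s ∈ Ico 0 t, HasDerivWithinAt (fun s => ‖F (T s x)‖ ^ 2)
      (2 * RCLike.re ⟪F (T s (A x)), F (T s x)⟫_𝕜) (Ici s) s := by
    intro s hs
    obtain ⟨hm, hAs⟩ := hA.apply_mem x hs.1
    have h1 := tendsto_normSq_quotient F (hA.tendsto ⟨_, hm⟩)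
    rw [hAs] at h1
    rw [← hasDerivWithinAt_Ioi_iff_Ici, hasDerivWithinAt_iff_tendsto_slope' self_notMem_Ioi]
    have h2 : Tendsto (fun z : ℝ => z - s) (𝓝[>] s) (𝓝[>] 0) := by
      refine tendsto_nhdsWithin_iff.2 ⟨?_, ?_⟩
      · have : Continuous fun z : ℝ => z - s := by fun_prop
        simpa using (this.tendsto s).mono_left nhdsWithin_le_nhds
      · filter_upwards [self_mem_nhdsWithin] with z hz using mem_Ioi.2 (sub_pos.2 hz)
    refine (h1.comp h2).congr' ?_
    filter_upwards [self_mem_nhdsWithin] with z hz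
    have hz' : 0 ≤ z - s := (sub_pos.2 hz).le
    simp only [Function.comp_apply]
    rw [← T.add_apply hz' hs.1, sub_add_cancel, slope_def_field]
  have h := image_le_of_deriv_right_le_deriv_boundary hcont hderiv (B := fun _ => ‖F x‖ ^ 2)
    (B' := fun _ => 0) (by simp) continuousOn_const (fun _ _ => hasDerivWithinAt_const _ _ _)
    (fun s hs => by
      obtain ⟨hm, hAs⟩ := hA.apply_mem x hs.1
      have := hF ⟨_, hm⟩
      rw [hAs] at this
      change RCLike.re ⟪F (T s (A x)), F (T s x)⟫_𝕜 ≤ 0 at this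
      linarith) (right_mem_Icc.2 ht)
  exact le_of_sq_le_sq h (norm_nonneg _)

end Hilbert

/-! ### Pull-back scalar products and the Lyapunov integral -/

section Lyapunov

variable {𝕜 X : Type*} [RCLike 𝕜] [NormedAddCommGroup X] [InnerProductSpace 𝕜 X]

/-- The scalar product `⟨F x, F y⟩` for an injective operator `F`. -/
@[reducible]
noncomputable def pullbackCore (F : X →L[𝕜] X) (hF : Function.Injective F) :
    InnerProductSpace.Core 𝕜 X where
  inner x y := ⟪F x, F y⟫_𝕜
  conj_inner_symm x y := inner_conj_symm _ _
  re_inner_nonneg x := inner_self_nonneg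
  add_left x y z := by rw [map_add, inner_add_left]
  smul_left x y r := by rw [map_smul, inner_smul_left]
  definite x h := hF (by rw [inner_self_eq_zero.1 h, map_zero])

theorem scalarNormSq_pullbackCore (F : X →L[𝕜] X) (hF : Function.Injective F) :
    scalarNormSq (pullbackCore F hF) = fun x => ‖F x‖ ^ 2 :=
  funext fun x => inner_self_eq_norm_sq (𝕜 := 𝕜) (F x)

theorem isEquivalentScalarProduct_pullbackCore (F : X →L[𝕜] X) (hF : Function.Injective F)
    (h : IsEquivalentToNorm fun x => ‖F x‖) : IsEquivalentScalarProduct (pullbackCore F hF) := by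
  unfold IsEquivalentScalarProduct
  simpa only [scalarNormSq_pullbackCore, Real.sqrt_sq (norm_nonneg _)] using h

theorem ContinuousLinearEquiv.isEquivalentToNorm (F : X ≃L[𝕜] X) :
    IsEquivalentToNorm fun x => ‖F x‖ := by
  -- Adding `1` keeps both constants positive when `X` is trivial.
  have hc : 0 < ‖(F.symm : X →L[𝕜] X)‖ + 1 := by positivity
  refine ⟨(‖(F.symm : X →L[𝕜] X)‖ + 1)⁻¹, ‖(F : X →L[𝕜] X)‖ + 1, by positivity, by positivity,
    fun x => ⟨?_, ?_⟩⟩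
  · rw [inv_mul_le_iff₀ hc]
    have h1 := (F.symm : X →L[𝕜] X).le_opNorm (F x)
    have h2 : (F.symm : X →L[𝕜] X) (F x) = x := F.symm_apply_apply x
    rw [h2] at h1
    linarith [norm_nonneg (F x)]
  · have h1 : ‖F x‖ ≤ ‖(F : X →L[𝕜] X)‖ * ‖x‖ := (F : X →L[𝕜] X).le_opNorm x
    linarith [norm_nonneg x]

theorem isQuadratic_normSq [CompleteSpace X] (F : X →L[𝕜] X) :
    IsQuadratic 𝕜 fun x => ‖F x‖ ^ 2 := by
  refine ⟨F.adjoint.comp F, ?_, fun x => ?_⟩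
  · rw [isSelfAdjoint_iff, ContinuousLinearMap.star_eq_adjoint,
      ContinuousLinearMap.adjoint_comp, ContinuousLinearMap.adjoint_adjoint]
  · rw [ContinuousLinearMap.comp_apply, ContinuousLinearMap.adjoint_inner_left,
      inner_self_eq_norm_sq_to_K, RCLike.ofReal_pow]

variable {T : C0Semigroup 𝕜 X}

theorem IsExpStable.integrableOn_inner (hT : IsExpStable T) :
    (∀ x y : X, IntegrableOn (fun t => ⟪T t x, T t y⟫_𝕜) (Ioi 0)) ∧
      ∃ K : ℝ, ∀ x : X, ‖∫ t in Ioi (0 : ℝ), ⟪T t x, T t x⟫_𝕜‖ ≤ K * ‖x‖ ^ 2 := by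
  obtain ⟨M, ω, hM, hω, h⟩ := hT.exists_bound
  have hexp : IntegrableOn (fun t : ℝ => Real.exp (-ω * t)) (Ioi 0) :=
    exp_neg_integrableOn_Ioi 0 hω
  have hle : ∀ (x y : X), ∀ᵐ t ∂volume.restrict (Ioi (0 : ℝ)),
      ‖⟪T t x, T t y⟫_𝕜‖ ≤ M ^ 2 * ‖x‖ * ‖y‖ * Real.exp (-ω * t) := by
    intro x y
    filter_upwards [self_mem_ae_restrict measurableSet_Ioi] with t ht
    have ht' : 0 ≤ t := le_of_lt ht
    have h1 : Real.exp (-ω * t) ≤ 1 := by rw [Real.exp_le_one_iff]; nlinarith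
    calc ‖⟪T t x, T t y⟫_𝕜‖ ≤ ‖T t x‖ * ‖T t y‖ := norm_inner_le_norm _ _
      _ ≤ (M * Real.exp (-ω * t) * ‖x‖) * (M * 1 * ‖y‖) := by
          gcongr
          · exact (T t).le_of_opNorm_le (h t ht') x
          · exact (T t).le_of_opNorm_le ((h t ht').trans (by gcongr)) y
      _ = _ := by ring
  refine ⟨fun x y => (hexp.const_mul (M ^ 2 * ‖x‖ * ‖y‖)).mono' ?_ (hle x y),
    M ^ 2 * ∫ t in Ioi (0 : ℝ), Real.exp (-ω * t), fun x => ?_⟩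
  · exact (((C0Semigroup.continuousOn_orbit hT x).inner
      (C0Semigroup.continuousOn_orbit hT y)).mono Ioi_subset_Ici_self).aestronglyMeasurable
      measurableSet_Ioi
  · refine (norm_integral_le_of_norm_le (hexp.const_mul _) (hle x x)).trans (le_of_eq ?_)
    rw [integral_const_mul]; ring

/-- Adding the Lyapunov integral to `‖F x‖²` turns mere contractivity into strict decay: moving from
`x` to `T h x` cuts `[0, h]` off the integral. -/
theorem exists_normSq_decay [CompleteSpace X] (hT : IsExpStable T) (F : X ≃L[𝕜] X)
    (hF : ∀ t : ℝ, 0 ≤ t → ∀ x, ‖F (T t x)‖ ≤ ‖F x‖) :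
    ∃ G : X ≃L[𝕜] X, ∀ (x : X) (h : ℝ), 0 ≤ h →
      ‖G (T h x)‖ ^ 2 ≤ ‖G x‖ ^ 2 - ∫ t in (0 : ℝ)..h, ‖T t x‖ ^ 2 := by
  obtain ⟨hint, K, hK⟩ := hT.integrableOn_inner
  have hsq : ∀ x, IntegrableOn (fun t => ‖T t x‖ ^ 2) (Ioi 0) := fun x => by
    have h := (hint x x).re
    simp only [inner_self_eq_norm_sq] at h
    exact h
  have hself : ∀ x, ∫ t in Ioi (0 : ℝ), ⟪T t x, T t x⟫_𝕜 =
      ((∫ t in Ioi (0 : ℝ), ‖T t x‖ ^ 2 : ℝ) : 𝕜) := fun x => by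
    rw [← integral_ofReal]
    simp only [inner_self_eq_norm_sq_to_K, RCLike.ofReal_pow]
  have hre : ∀ x, RCLike.re (⟪F x, F x⟫_𝕜 + ∫ t in Ioi (0 : ℝ), ⟪T t x, T t x⟫_𝕜) =
      ‖F x‖ ^ 2 + ∫ t in Ioi (0 : ℝ), ‖T t x‖ ^ 2 := fun x => by
    rw [map_add, inner_self_eq_norm_sq, hself, RCLike.ofReal_re]
  have hnn : ∀ x, 0 ≤ ∫ t in Ioi (0 : ℝ), ‖T t x‖ ^ 2 := fun x =>
    integral_nonneg fun t => by positivity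
  let S : InnerProductSpace.Core 𝕜 X :=
    { inner := fun x y => ⟪F x, F y⟫_𝕜 + ∫ t in Ioi (0 : ℝ), ⟪T t x, T t y⟫_𝕜
      conj_inner_symm := fun x y => by
        rw [map_add, inner_conj_symm, ← integral_conj]
        simp only [inner_conj_symm]
      re_inner_nonneg := fun x => by
        rw [hre]
        have := hnn x
        positivity
      add_left := fun x y z => by
        simp only [map_add, inner_add_left]
        rw [integral_add (hint x z) (hint y z)]
        ring
      smul_left := fun x y r => by
        simp only [map_smul, inner_smul_left]
        rw [integral_const_mul]
        ring
      definite := fun x hx => by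
        have h1 := hre x
        rw [hx, map_zero] at h1
        have h2 : ‖F x‖ ^ 2 = 0 := le_antisymm (by linarith [hnn x]) (by positivity)
        exact F.injective (by rw [norm_eq_zero.1 (pow_eq_zero_iff two_ne_zero |>.1 h2), map_zero]) }
  have hS : ∀ x, scalarNormSq S x = ‖F x‖ ^ 2 + ∫ t in Ioi (0 : ℝ), ‖T t x‖ ^ 2 := hre
  have hSe : IsEquivalentScalarProduct S := by
    obtain ⟨c, C, hc, hC, h⟩ := F.isEquivalentToNorm
    -- The lower bound comes from `F` alone. The truncation at `0` is there because the sign of `K`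
    -- is not recorded.
    refine ⟨c, C + √(max K 0), hc, by positivity, fun x => ⟨?_, ?_⟩⟩
    · refine Real.le_sqrt_of_sq_le ?_
      rw [hS]
      have h1 : (c * ‖x‖) ^ 2 ≤ ‖F x‖ ^ 2 := by gcongr; exact (h x).1
      linarith [hnn x]
    · refine (Real.sqrt_le_left (by positivity)).2 ?_
      rw [hS]
      have h1 : ‖F x‖ ^ 2 ≤ (C * ‖x‖) ^ 2 := by gcongr; exact (h x).2
      have h2 : ∫ t in Ioi (0 : ℝ), ‖T t x‖ ^ 2 ≤ K * ‖x‖ ^ 2 := by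
        have := hK x
        rwa [hself, RCLike.norm_ofReal, abs_of_nonneg (hnn x)] at this
      have h3 : K * ‖x‖ ^ 2 ≤ √(max K 0) ^ 2 * ‖x‖ ^ 2 := by
        rw [Real.sq_sqrt (le_max_right _ _)]
        gcongr
        exact le_max_left _ _
      have h4 : 0 ≤ C * √(max K 0) * ‖x‖ ^ 2 := by positivity
      nlinarith
  obtain ⟨G, hG⟩ := hSe.exists_equiv
  have hGS : ∀ x, ‖G x‖ ^ 2 = ‖F x‖ ^ 2 + ∫ t in Ioi (0 : ℝ), ‖T t x‖ ^ 2 := fun x => by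
    rw [← hS, scalarNormSq, hG, inner_self_eq_norm_sq]
  refine ⟨G, fun x h hh => ?_⟩
  have hshift : ∫ t in Ioi (0 : ℝ), ‖T t (T h x)‖ ^ 2 = ∫ t in Ioi h, ‖T t x‖ ^ 2 := by
    rw [← (measurePreserving_add_right volume h).setIntegral_preimage_emb
      (measurableEmbedding_addRight h) (fun t => ‖T t x‖ ^ 2) (Ioi h), preimage_add_const_Ioi,
      sub_self]
    refine setIntegral_congr_fun measurableSet_Ioi fun t ht => ?_
    simp only [T.add_apply (le_of_lt ht) hh]
  rw [hGS, hGS, hshift, ← intervalIntegral.integral_Ioi_sub_Ioi (hsq x) hh]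
  have h1 : ‖F (T h x)‖ ^ 2 ≤ ‖F x‖ ^ 2 := by gcongr; exact hF h hh x
  linarith

end Lyapunov

theorem isClassKInf_const_mul_sq {a : ℝ≥0} (ha : 0 < a) : IsClassKInf fun r => a * r ^ 2 := by
  refine ⟨⟨by fun_prop, fun r s hrs => ?_, by simp⟩, ?_⟩
  · have : r ^ 2 < s ^ 2 := by gcongr
    exact mul_lt_mul_of_pos_left this ha
  · exact (tendsto_pow_atTop two_ne_zero).const_mul_atTop ha

/-! ### Dini derivatives, mild solutions and bounds on inputs near time zero -/

section Dini

theorem diniDeriv_le_of_eventually_le {X : Type*} {V : X → ℝ} {φ : ℝ → X} {r : ℝ → ℝ} {l : ℝ}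
    (h : ∀ᶠ t in 𝓝[>] (0 : ℝ), (V (φ t) - V (φ 0)) / t ≤ r t)
    (hr : Tendsto r (𝓝[>] 0) (𝓝 l)) : diniDeriv V φ ≤ (l : EReal) := by
  have h1 : Tendsto (fun t => (r t : EReal)) (𝓝[>] 0) (𝓝 (l : EReal)) :=
    (continuous_coe_real_ereal.tendsto l).comp hr
  rw [← h1.limsup_eq]
  exact limsup_le_limsup (h.mono fun t ht => EReal.coe_le_coe_iff.2 ht)

theorem diniDeriv_eq_of_tendsto {X : Type*} {V : X → ℝ} {φ : ℝ → X} {l : ℝ}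
    (h : Tendsto (fun t => (V (φ t) - V (φ 0)) / t) (𝓝[>] 0) (𝓝 l)) :
    diniDeriv V φ = (l : EReal) :=
  ((continuous_coe_real_ereal.tendsto l).comp h).limsup_eq

variable {𝕜 X U : Type*} [RCLike 𝕜] [NormedAddCommGroup X] [NormedSpace 𝕜 X]
  [NormedAddCommGroup U] [NormedSpace 𝕜 U]

@[simp] theorem mildSolution_zero_time (T : C0Semigroup 𝕜 X) (B : U →L[𝕜] X) (x : X)
    (u : ℝ → U) : mildSolution T B x u 0 = x := by
  simp [mildSolution]

@[simp] theorem mildSolution_zero_operator (T : C0Semigroup 𝕜 X) (x : X) (u : ℝ → U) :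
    mildSolution T (0 : U →L[𝕜] X) x u = fun t => T t x := by
  funext t
  simp [mildSolution]

@[simp] theorem mildSolution_zero_input (T : C0Semigroup 𝕜 X) (B : U →L[𝕜] X) (x : X) :
    mildSolution T B x (0 : ℝ → U) = fun t => T t x := by
  funext t
  simp [mildSolution]

/-- Boundedness of `B` makes the effect of the input linear in `h`, with a constant depending on the
input only through its essential bound on `(0, h)`. -/
theorem norm_mildSolution_sub_le {T : C0Semigroup 𝕜 X} {M : ℝ}
    (hM : ∀ t : ℝ, 0 ≤ t → ‖T t‖ ≤ M) (B : U →L[𝕜] X) (x : X) {u : ℝ → U} {c h : ℝ}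
    (hh : 0 ≤ h) (hu : ∀ᵐ s, s ∈ Ioo 0 h → ‖u s‖ ≤ c) :
    ‖mildSolution T B x u h - T h x‖ ≤ M * ‖B‖ * c * h := by
  let : NormedSpace ℝ X := NormedSpace.restrictScalars ℝ 𝕜 X
  have h1 : mildSolution T B x u h - T h x = ∫ s in (0 : ℝ)..h, T (h - s) (B (u s)) :=
    add_sub_cancel_left _ _
  have hne : ∀ᵐ s : ℝ, s ≠ h := ae_iff.2 (by simp)
  have h2 : ∀ᵐ s : ℝ, s ∈ uIoc 0 h → ‖T (h - s) (B (u s))‖ ≤ M * ‖B‖ * c := by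
    filter_upwards [hu, hne] with s hs hsh hmem
    rw [uIoc_of_le hh] at hmem
    have h3 := (T (h - s)).le_of_opNorm_le (hM _ (sub_nonneg.2 hmem.2)) (B (u s))
    have hM0 : 0 ≤ M := (norm_nonneg _).trans (hM 0 le_rfl)
    have h4 : ‖B (u s)‖ ≤ ‖B‖ * c :=
      B.le_opNorm_of_le (hs ⟨hmem.1, lt_of_le_of_ne hmem.2 hsh⟩)
    calc _ ≤ M * ‖B (u s)‖ := h3
      _ ≤ M * (‖B‖ * c) := by gcongr
      _ = _ := by ring
  have h5 := intervalIntegral.norm_integral_le_of_norm_le_const_ae h2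
  rwa [← h1, sub_zero, abs_of_nonneg hh] at h5

/-- This and its analogue for continuous inputs bring both input classes into one form, so that a
single Dini estimate serves both kinds of Lyapunov function. -/
theorem eventually_ae_norm_le_of_initialEssSup_lt {u : ℝ → U} (hu : IsLocEssBounded u) {c : ℝ}
    (hc : (initialEssSup u : ℝ) < c) :
    ∀ᶠ h in 𝓝[>] (0 : ℝ), ∀ᵐ s, s ∈ Ioo 0 h → ‖u s‖ ≤ c := by
  lift c to ℝ≥0 using (NNReal.coe_nonneg _).trans hc.le
  -- Finiteness is essential: `toNNReal` sends `∞` to `0`.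
  have hfin : limsup (fun t : ℝ => eLpNorm u ∞ (volume.restrict (Ioo 0 t))) (𝓝[>] 0) ≠ ∞ := by
    refine ne_top_of_le_ne_top (hu 1 one_pos).eLpNorm_ne_top (limsup_le_of_le (by isBoundedDefault) ?_)
    filter_upwards [Ioo_mem_nhdsGT (zero_lt_one' ℝ)] with t ht
    exact eLpNorm_mono_measure _ (Measure.restrict_mono (Ioo_subset_Ioo_right ht.2.le) le_rfl)
  have hlt : limsup (fun t : ℝ => eLpNorm u ∞ (volume.restrict (Ioo 0 t))) (𝓝[>] 0) < c := by
    rw [← ENNReal.coe_toNNReal hfin]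
    exact_mod_cast hc
  filter_upwards [eventually_lt_of_limsup_lt hlt] with h hh
  rw [eLpNorm_exponent_top] at hh
  rw [← ae_restrict_iff' measurableSet_Ioo]
  filter_upwards [enorm_ae_le_eLpNormEssSup u (volume.restrict (Ioo 0 h))] with s hs
  have h1 : ‖u s‖ₑ ≤ c := hs.trans hh.le
  exact_mod_cast h1

theorem eventually_ae_norm_le_of_continuousOn {u : ℝ → U} (hu : ContinuousOn u (Ici 0)) {c : ℝ}
    (hc : ‖u 0‖ < c) : ∀ᶠ h in 𝓝[>] (0 : ℝ), ∀ᵐ s, s ∈ Ioo 0 h → ‖u s‖ ≤ c := by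
  have h1 : ∀ᶠ s in 𝓝[≥] (0 : ℝ), ‖u s‖ < c :=
    ((hu 0 self_mem_Ici).norm.eventually_lt_const hc)
  obtain ⟨ε, hε, h2⟩ := mem_nhdsGE_iff_exists_Ico_subset.1 h1
  filter_upwards [Ioo_mem_nhdsGT hε] with h hh
  exact Eventually.of_forall fun s hs => (h2 ⟨hs.1.le, hs.2.trans hh.2⟩).le

theorem initialEssSup_zero : initialEssSup (0 : ℝ → U) = 0 := by
  simp [initialEssSup]

theorem isLocEssBounded_zero : IsLocEssBounded (0 : ℝ → U) := fun _ _ => MemLp.zero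

end Dini

/-! ### From decay along the semigroup to Dini estimates -/

section Decay

variable {𝕜 X U : Type*} [RCLike 𝕜] [NormedAddCommGroup X] [InnerProductSpace 𝕜 X]
  [NormedAddCommGroup U] [NormedSpace 𝕜 U] {T : C0Semigroup 𝕜 X}

theorem tendsto_average_orbit_normSq (hT : IsExpStable T) (x : X) :
    Tendsto (fun h : ℝ => h⁻¹ * ∫ t in (0 : ℝ)..h, ‖T t x‖ ^ 2) (𝓝[>] 0) (𝓝 (‖x‖ ^ 2)) := by
  simpa using tendsto_inv_mul_integral_nhdsGT
    ((C0Semigroup.continuousOn_orbit hT x).norm.pow 2)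

theorem integral_orbit_normSq_nonneg (T : C0Semigroup 𝕜 X) (x : X) {h : ℝ} (hh : 0 ≤ h) :
    0 ≤ ∫ t in (0 : ℝ)..h, ‖T t x‖ ^ 2 :=
  intervalIntegral.integral_nonneg hh fun _ _ => by positivity

/-- Split the solution as `T h x + z` with `‖z‖ ≤ k c h`. After division by `h` the decay tends to
`-‖x‖²`, the cross term is at most `2 g² k c ‖x‖`, and the term quadratic in `z` vanishes in the
limit. -/
theorem exists_diniDeriv_normSq_le (hT : IsExpStable T) (B : U →L[𝕜] X) (G : X →L[𝕜] X)
    (hG : ∀ (x : X) (h : ℝ), 0 ≤ h →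
      ‖G (T h x)‖ ^ 2 ≤ ‖G x‖ ^ 2 - ∫ t in (0 : ℝ)..h, ‖T t x‖ ^ 2) :
    ∃ C : ℝ≥0, 0 < C ∧ ∀ (x : X) (u : ℝ → U) (b : ℝ), 0 ≤ b →
      (∀ c, b < c → ∀ᶠ h in 𝓝[>] (0 : ℝ), ∀ᵐ s, s ∈ Ioo 0 h → ‖u s‖ ≤ c) →
      diniDeriv (fun y => ‖G y‖ ^ 2) (mildSolution T B x u) ≤
        ((-((1 / 2 : ℝ) * ‖x‖ ^ 2) + C * b ^ 2 : ℝ) : EReal) := by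
  obtain ⟨M, hM0, hM⟩ := hT.exists_uniform_bound
  set g := ‖G‖ with hg
  have hg0 : 0 ≤ g := norm_nonneg _
  set k := M * ‖B‖ with hk
  have hk0 : 0 ≤ k := by positivity
  -- Young: `2 g² k c ‖x‖ ≤ ‖x‖² / 2 + 2 (g² k c)²`. The summand `1` keeps the constant positive
  -- when `B` or `G` is zero.
  refine ⟨NNReal.mk (2 * (g ^ 2 * k) ^ 2 + 1) (by positivity),
    by rw [← NNReal.coe_pos, NNReal.coe_mk]; positivity, ?_⟩
  intro x u b hb hub
  rw [NNReal.coe_mk]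
  have key : ∀ c, b < c → diniDeriv (fun y => ‖G y‖ ^ 2) (mildSolution T B x u) ≤
      ((-((1 / 2 : ℝ) * ‖x‖ ^ 2) + (2 * (g ^ 2 * k) ^ 2 + 1) * c ^ 2 : ℝ) : EReal) := by
    intro c hc
    have hc0 : 0 ≤ c := hb.trans hc.le
    have hlim : Tendsto (fun h : ℝ => -(h⁻¹ * ∫ t in (0 : ℝ)..h, ‖T t x‖ ^ 2) +
        (2 * (g * ‖x‖) * (g * (k * c)) + (g * (k * c)) ^ 2 * h)) (𝓝[>] 0)
        (𝓝 (-‖x‖ ^ 2 + (2 * (g * ‖x‖) * (g * (k * c)) + (g * (k * c)) ^ 2 * 0))) := by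
      refine (tendsto_average_orbit_normSq hT x).neg.add (tendsto_const_nhds.add ?_)
      exact (tendsto_id.mono_left nhdsWithin_le_nhds).const_mul _
    refine (diniDeriv_le_of_eventually_le ?_ hlim).trans (EReal.coe_le_coe_iff.2 ?_)
    · filter_upwards [hub c hc, self_mem_nhdsWithin] with h hu hh
      have hh0 : (0 : ℝ) < h := hh
      rw [mildSolution_zero_time]
      set z := mildSolution T B x u h - T h x with hz
      have h1 : ‖z‖ ≤ k * c * h := norm_mildSolution_sub_le hM B x hh0.le hu
      have h2 : mildSolution T B x u h = T h x + z := by rw [hz]; abel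
      have hI := integral_orbit_normSq_nonneg T x hh0.le
      have h3 := hG x h hh0.le
      have h4 : ‖G (T h x)‖ ≤ g * ‖x‖ :=
        (le_of_sq_le_sq (by linarith) (norm_nonneg _)).trans (G.le_opNorm x)
      have h5 : ‖G z‖ ≤ g * (k * c * h) := G.le_opNorm_of_le h1
      have h6 : ‖G (T h x + z)‖ ^ 2 ≤ (‖G (T h x)‖ + ‖G z‖) ^ 2 := by
        rw [map_add]; gcongr; exact norm_add_le _ _
      have h7 : ‖G (T h x)‖ * ‖G z‖ ≤ (g * ‖x‖) * (g * (k * c * h)) := by gcongr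
      have h8 : ‖G z‖ ^ 2 ≤ (g * (k * c * h)) ^ 2 := by gcongr
      rw [h2, div_le_iff₀ hh0]
      have h9 : (-(h⁻¹ * ∫ t in (0 : ℝ)..h, ‖T t x‖ ^ 2) +
          (2 * (g * ‖x‖) * (g * (k * c)) + (g * (k * c)) ^ 2 * h)) * h =
          -(∫ t in (0 : ℝ)..h, ‖T t x‖ ^ 2) + 2 * ((g * ‖x‖) * (g * (k * c * h))) +
            (g * (k * c * h)) ^ 2 := by
        field_simp
        ring
      rw [h9]
      nlinarith
    · nlinarith [sq_nonneg (‖x‖ - 2 * (g ^ 2 * k * c)), sq_nonneg c]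
  have hcont : Continuous fun c : ℝ =>
      ((-((1 / 2 : ℝ) * ‖x‖ ^ 2) + (2 * (g ^ 2 * k) ^ 2 + 1) * c ^ 2 : ℝ) : EReal) :=
    continuous_coe_real_ereal.comp (by fun_prop)
  -- The input is controlled only by each `c > b`, so the estimate at `b` is the limit `c ↓ b`.
  refine ge_of_tendsto ((hcont.tendsto b).mono_left (nhdsWithin_le_nhds (s := Ioi b))) ?_
  filter_upwards [self_mem_nhdsWithin] with c hc using key c hc

theorem isISSLyapunov_normSq (hT : IsExpStable T) (B : U →L[𝕜] X) (G : X →L[𝕜] X)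
    (hGi : Function.Injective G) (hG : ∀ (x : X) (h : ℝ), 0 ≤ h →
      ‖G (T h x)‖ ^ 2 ≤ ‖G x‖ ^ 2 - ∫ t in (0 : ℝ)..h, ‖T t x‖ ^ 2) :
    IsISSLyapunov T B fun x => ‖G x‖ ^ 2 := by
  obtain ⟨C, hC, h⟩ := exists_diniDeriv_normSq_le hT B G hG
  refine ⟨by fun_prop, fun x => by positivity, fun r => (‖G‖₊ ^ 2 + 1) * r ^ 2,
    fun r => (1 / 2) * r ^ 2, fun r => C * r ^ 2, (isClassKInf_const_mul_sq (by positivity)).1,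
    isClassKInf_const_mul_sq (by positivity), isClassKInf_const_mul_sq hC, fun x hx => ⟨?_, ?_⟩,
    fun x u hu => ?_⟩
  · have : G x ≠ 0 := fun h0 => hx (hGi (by rw [h0, map_zero]))
    positivity
  · push_cast
    have h1 : ‖G x‖ ^ 2 ≤ (‖G‖ * ‖x‖) ^ 2 := by gcongr; exact G.le_opNorm x
    nlinarith [sq_nonneg ‖x‖]
  · have := h x u (initialEssSup u) (NNReal.coe_nonneg _) fun c hc =>
      eventually_ae_norm_le_of_initialEssSup_lt hu hc
    simpa using this

theorem isLpISSLyapunov_two_normSq (hT : IsExpStable T) (B : U →L[𝕜] X) (G : X →L[𝕜] X)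
    (hGi : Function.Injective G) (hG : ∀ (x : X) (h : ℝ), 0 ≤ h →
      ‖G (T h x)‖ ^ 2 ≤ ‖G x‖ ^ 2 - ∫ t in (0 : ℝ)..h, ‖T t x‖ ^ 2) :
    IsLpISSLyapunov 2 T B fun x => ‖G x‖ ^ 2 := by
  obtain ⟨C, hC, h⟩ := exists_diniDeriv_normSq_le hT B G hG
  refine ⟨by fun_prop, fun x => by positivity, ⟨fun r => (‖G‖₊ ^ 2 + 1) * r ^ 2,
    isClassKInf_const_mul_sq (by positivity), fun x hx => ⟨?_, ?_⟩⟩, 1 / 2, C, by norm_num,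
    by exact_mod_cast hC, fun x u hu => ?_⟩
  · have : G x ≠ 0 := fun h0 => hx (hGi (by rw [h0, map_zero]))
    positivity
  · push_cast
    have h1 : ‖G x‖ ^ 2 ≤ (‖G‖ * ‖x‖) ^ 2 := by gcongr; exact G.le_opNorm x
    nlinarith [sq_nonneg ‖x‖]
  · have := h x u ‖u 0‖ (norm_nonneg _) fun c hc => eventually_ae_norm_le_of_continuousOn hu hc
    simpa using this

/-- Dividing the decay of the squares by `‖G (T h x)‖ + ‖G x‖ ≤ 2 ‖G x‖` gives the rate `-‖x‖² / (2
‖G x‖)`, and `‖G x‖² ≤ K ‖x‖²` bounds it by `-‖G x‖ / (2 K)`. -/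
theorem exists_diniDeriv_norm_le (hT : IsExpStable T) (G : X →L[𝕜] X)
    (hGi : Function.Injective G) (hG : ∀ (x : X) (h : ℝ), 0 ≤ h →
      ‖G (T h x)‖ ^ 2 ≤ ‖G x‖ ^ 2 - ∫ t in (0 : ℝ)..h, ‖T t x‖ ^ 2) :
    ∃ a : ℝ, 0 < a ∧ ∀ x : X,
      diniDeriv (fun y => ‖G y‖) (fun t => T t x) ≤ ((-a * ‖G x‖ : ℝ) : EReal) := by
  set K := ‖G‖ ^ 2 + 1 with hK
  have hK0 : 0 < K := by positivity
  refine ⟨1 / (2 * K), by positivity, fun x => ?_⟩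
  rcases eq_or_ne x 0 with rfl | hx
  · refine diniDeriv_le_of_eventually_le (r := fun _ => 0) (Eventually.of_forall fun t => ?_) ?_ <;>
      simp
  have hw : 0 < ‖G x‖ := norm_pos_iff.2 fun h0 => hx (hGi (by rw [h0, map_zero]))
  have hlim := ((tendsto_average_orbit_normSq hT x).neg.div_const (2 * ‖G x‖))
  refine (diniDeriv_le_of_eventually_le ?_ hlim).trans (EReal.coe_le_coe_iff.2 ?_)
  · filter_upwards [self_mem_nhdsWithin] with h hh
    have hh0 : (0 : ℝ) < h := hh
    have hI := integral_orbit_normSq_nonneg T x hh0.le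
    have h1 := hG x h hh0.le
    have h2 : ‖G (T h x)‖ ≤ ‖G x‖ := le_of_sq_le_sq (by linarith) hw.le
    rw [T.zero_apply, div_le_div_iff₀ hh0 (by positivity)]
    have h3 : -(h⁻¹ * ∫ t in (0 : ℝ)..h, ‖T t x‖ ^ 2) * h = -∫ t in (0 : ℝ)..h, ‖T t x‖ ^ 2 := by
      field_simp
    rw [h3]
    nlinarith
  · have h1 : ‖G x‖ ^ 2 ≤ K * ‖x‖ ^ 2 := by
      have h1 : ‖G x‖ ^ 2 ≤ (‖G‖ * ‖x‖) ^ 2 := by gcongr; exact G.le_opNorm x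
      nlinarith [sq_nonneg ‖x‖]
    rw [div_le_iff₀ (by positivity)]
    have h2 : -(1 / (2 * K)) * ‖G x‖ * (2 * ‖G x‖) = -(‖G x‖ ^ 2 / K) := by field_simp
    rw [h2, neg_le_neg_iff, div_le_iff₀ hK0]
    linarith

end Decay

/-! ### From Lyapunov functions back to dissipativity and similarity -/

section Dissipativity

variable {𝕜 X U : Type*} [RCLike 𝕜] [NormedAddCommGroup X] [InnerProductSpace 𝕜 X]
  [NormedAddCommGroup U] [NormedSpace 𝕜 U] {A : X →ₗ.[𝕜] X} {T : C0Semigroup 𝕜 X}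

theorem isDissipative_pullbackCore_of_diniDeriv_normSq_nonpos (hA : IsGenerator A T)
    (F : X →L[𝕜] X) (hF : Function.Injective F)
    (h : ∀ x, diniDeriv (fun y => ‖F y‖ ^ 2) (fun t => T t x) ≤ 0) :
    IsDissipative A (pullbackCore F hF) := by
  intro x
  have h1 := tendsto_normSq_quotient F (hA.tendsto x)
  have h2 := h x
  rw [diniDeriv_eq_of_tendsto (l := 2 * RCLike.re ⟪F (A x), F x⟫_𝕜) (by simpa using h1)] at h2
  have h3 : 2 * RCLike.re ⟪F (A x), F x⟫_𝕜 ≤ 0 := by exact_mod_cast h2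
  change RCLike.re ⟪F (A x), F x⟫_𝕜 ≤ 0
  linarith

/-- For `x ≠ 0` the quotient for the norm is the quotient for its square divided by `‖F (T h x)‖ +
‖F x‖`, whose limit is positive; so both derivatives have the same sign. -/
theorem isDissipative_pullbackCore_of_diniDeriv_norm_nonpos (hA : IsGenerator A T)
    (F : X →L[𝕜] X) (hF : Function.Injective F)
    (h : ∀ x, diniDeriv (fun y => ‖F y‖) (fun t => T t x) ≤ 0) :
    IsDissipative A (pullbackCore F hF) := by
  intro x
  change RCLike.re ⟪F (A x), F x⟫_𝕜 ≤ 0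
  rcases eq_or_ne (x : X) 0 with hx | hx
  · simp [hx]
  have hw : 0 < ‖F x‖ := norm_pos_iff.2 fun h0 => hx (hF (by rw [h0, map_zero]))
  have h1 := tendsto_normSq_quotient F (hA.tendsto x)
  have h2 : Tendsto (fun h => ‖F (T h x)‖ + ‖F x‖) (𝓝[>] 0) (𝓝 (‖F x‖ + ‖F x‖)) :=
    (((F.continuous.tendsto _).comp (T.tendsto_zero' x)).norm).add_const _
  have h3 : Tendsto (fun h => (‖F (T h x)‖ - ‖F x‖) / h) (𝓝[>] 0)
      (𝓝 (2 * RCLike.re ⟪F (A x), F x⟫_𝕜 / (‖F x‖ + ‖F x‖))) := by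
    refine (h1.div h2 (by positivity)).congr fun h => ?_
    have h4 : ‖F (T h x)‖ + ‖F x‖ ≠ 0 := by positivity
    rw [Pi.div_apply, div_right_comm]
    congr 1
    field_simp
    ring
  have h5 := h x
  rw [diniDeriv_eq_of_tendsto (by simpa using h3)] at h5
  have h6 : 2 * RCLike.re ⟪F (A x), F x⟫_𝕜 / (‖F x‖ + ‖F x‖) ≤ 0 := by exact_mod_cast h5
  rw [div_le_iff₀ (by positivity)] at h6
  linarith

theorem IsEquivalentScalarProduct.isSimilarToContraction [CompleteSpace X]
    (hA : IsGenerator A T) (hT : IsExpStable T) {S : InnerProductSpace.Core 𝕜 X}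
    (hS : IsEquivalentScalarProduct S) (hd : IsDissipative A S) : IsSimilarToContraction T := by
  obtain ⟨F, hF⟩ := hS.exists_equiv
  refine ⟨F, fun t ht => ContinuousLinearMap.opNorm_le_bound _ zero_le_one fun x => ?_⟩
  have h1 := norm_apply_semigroup_le_of_dissipative hA hT (F : X →L[𝕜] X)
    (fun x => (congrArg RCLike.re (hF (A x) x)).symm.trans_le (hd x)) ht (F.symm x)
  simpa using h1

theorem IsSimilarToContraction.exists_normSq_decay [CompleteSpace X] (hT : IsExpStable T)
    (h : IsSimilarToContraction T) :
    ∃ G : X ≃L[𝕜] X, ∀ (x : X) (h : ℝ), 0 ≤ h →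
      ‖G (T h x)‖ ^ 2 ≤ ‖G x‖ ^ 2 - ∫ t in (0 : ℝ)..h, ‖T t x‖ ^ 2 := by
  obtain ⟨S, hS⟩ := h
  refine _root_.exists_normSq_decay hT S fun t ht x => ?_
  simpa using ContinuousLinearMap.le_of_opNorm_le _ (hS t ht) (S x)

/-- A quadratic form is determined on the unit sphere, so by scaling any `𝒦_∞` lower bound `α`
improves to `α 1 * ‖x‖ ^ 2`, and the operator of `V` is coercive. -/
theorem exists_equiv_normSq_eq_of_isQuadratic [CompleteSpace X] {V : X → ℝ}
    (hq : IsQuadratic 𝕜 V) (hc : HasCoerciveLowerBound V) :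
    ∃ F : X ≃L[𝕜] X, ∀ x, V x = ‖F x‖ ^ 2 := by
  obtain ⟨P, hP, hPV⟩ := hq
  obtain ⟨α, ⟨⟨-, hmono, h0⟩, -⟩, hα⟩ := hc
  have hre : ∀ x, RCLike.re ⟪P x, x⟫_𝕜 = V x := fun x => by rw [← hPV, RCLike.ofReal_re]
  have hα1 : 0 < (α 1 : ℝ) := by
    have := hmono (zero_lt_one' ℝ≥0)
    rw [h0] at this
    exact_mod_cast this
  obtain ⟨F, hF⟩ := exists_equiv_inner_eq_of_coercive P hP hα1 fun x => by
    rcases eq_or_ne x 0 with rfl | hx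
    · simp
    have hx' : ‖x‖ ≠ 0 := norm_ne_zero_iff.2 hx
    have h1 := hα (((‖x‖⁻¹ : ℝ) : 𝕜) • x)
    have h2 : ‖((‖x‖⁻¹ : ℝ) : 𝕜) • x‖₊ = 1 := by
      apply NNReal.coe_injective
      rw [coe_nnnorm, norm_smul, RCLike.norm_ofReal, abs_of_nonneg (by positivity),
        inv_mul_cancel₀ hx', NNReal.coe_one]
    rw [h2, ← hre, map_smul, inner_smul_left, inner_smul_right, RCLike.conj_ofReal,
      RCLike.re_ofReal_mul, RCLike.re_ofReal_mul] at h1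
    calc (α 1 : ℝ) * ‖x‖ ^ 2 ≤ (‖x‖⁻¹ * (‖x‖⁻¹ * RCLike.re ⟪P x, x⟫_𝕜)) * ‖x‖ ^ 2 := by gcongr
      _ = _ := by field_simp
  exact ⟨F, fun x => by rw [← hre, hF, inner_self_eq_norm_sq]⟩

theorem IsISSLyapunov.diniDeriv_nonpos {V : X → ℝ}
    (hV : IsISSLyapunov T (0 : U →L[𝕜] X) V) (x : X) : diniDeriv V (fun t => T t x) ≤ 0 := by
  obtain ⟨-, -, -, α₃, σ, -, -, ⟨⟨-, -, hσ⟩, -⟩, -, h⟩ := hV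
  have h1 := h x 0 isLocEssBounded_zero
  rw [mildSolution_zero_operator, initialEssSup_zero, hσ] at h1
  refine h1.trans ?_
  have : (-(α₃ ‖x‖₊ : ℝ) + ((0 : ℝ≥0) : ℝ)) ≤ 0 := by simp
  exact_mod_cast this

theorem IsLpISSLyapunov.isISSLyapunov_zero {B : U →L[𝕜] X} {V : X → ℝ}
    (hV : IsLpISSLyapunov 2 T B V) : IsISSLyapunov T (0 : U →L[𝕜] X) V := by
  obtain ⟨hc, hn, ⟨α₂, hα₂, hV⟩, a₃, a₄, ha₃, -, h⟩ := hV
  -- With `B = 0` the input plays no role, so the estimate for zero input suffices and `σ` may be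
  -- any `𝒦_∞` function.
  refine ⟨hc, hn, α₂, fun r => NNReal.mk a₃ ha₃.le * r ^ 2, fun r => 1 * r ^ 2, hα₂.1,
    isClassKInf_const_mul_sq (by exact_mod_cast ha₃), isClassKInf_const_mul_sq one_pos, hV,
    fun x u _ => ?_⟩
  have h1 := h x 0 continuousOn_const
  rw [mildSolution_zero_input] at h1
  rw [mildSolution_zero_operator]
  refine h1.trans (EReal.coe_le_coe_iff.2 ?_)
  have h2 : (0 : ℝ) ≤ ((1 * initialEssSup u ^ 2 : ℝ≥0) : ℝ) := NNReal.coe_nonneg _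
  simp only [Pi.zero_apply, norm_zero, NNReal.coe_mul, NNReal.coe_mk, NNReal.coe_pow, coe_nnnorm]
  simp only [NNReal.coe_mul, NNReal.coe_pow] at h2
  rw [Real.zero_rpow two_ne_zero]
  linarith

end Dissipativity

/-! ### The equivalence -/

theorem mainTheorem1 {𝕜 X U : Type*} [RCLike 𝕜]
    [NormedAddCommGroup X] [InnerProductSpace 𝕜 X] [CompleteSpace X]
    [NormedAddCommGroup U] [NormedSpace 𝕜 U] [CompleteSpace U]
    (B : U →L[𝕜] X) (A : X →ₗ.[𝕜] X) (T : C0Semigroup 𝕜 X)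
    (hA : IsGenerator A T) (hT : IsExpStable T) :
    List.TFAE [
      -- (i) a coercive quadratic `L²`-ISS Lyapunov function
      ∃ V : X → ℝ, IsCoerciveQuadraticLpISSLyapunov 2 T B V,
      -- (ii) a coercive quadratic Lyapunov function for `B = 0`
      ∃ V : X → ℝ, IsISSLyapunov T (0 : U →L[𝕜] X) V ∧ IsQuadratic 𝕜 V ∧
        HasCoerciveLowerBound V,
      -- (iii) `A` is dissipative for an equivalent scalar product, whose squared norm is a
      -- quadratic ISS Lyapunov function
      ∃ S : InnerProductSpace.Core 𝕜 X, IsEquivalentScalarProduct S ∧ IsDissipative A S ∧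
        IsISSLyapunov T B (scalarNormSq S) ∧ IsQuadratic 𝕜 (scalarNormSq S),
      -- (iv) `A` is dissipative for an equivalent scalar product
      ∃ S : InnerProductSpace.Core 𝕜 X, IsEquivalentScalarProduct S ∧ IsDissipative A S,
      -- (v) `T` is similar to a contraction semigroup
      IsSimilarToContraction T,
      -- (vi) an equivalent norm `W(x) = ‖F x‖` that decays exponentially along `T`
      ∃ F : X →L[𝕜] X, IsEquivalentToNorm (fun x => ‖F x‖) ∧
        ∃ a : ℝ, 0 < a ∧ ∀ x : X,
          diniDeriv (fun y => ‖F y‖) (mildSolution T (0 : U →L[𝕜] X) x 0) ≤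
            ((-a * ‖F x‖ : ℝ) : EReal)] := by
  tfae_have 1 → 2 := by
    rintro ⟨V, hV, ⟨F, -, hF⟩, a₁, a₂, ha₁, -, h⟩
    refine ⟨V, hV.isISSLyapunov_zero, ?_, fun r => NNReal.mk a₁ ha₁.le * r ^ 2,
      isClassKInf_const_mul_sq (by exact_mod_cast ha₁), fun x => ?_⟩
    · rw [funext hF]
      exact isQuadratic_normSq F
    · simpa using (h x).1
  tfae_have 2 → 4 := by
    rintro ⟨V, hV, hq, hc⟩
    obtain ⟨F, hF⟩ := exists_equiv_normSq_eq_of_isQuadratic hq hc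
    refine ⟨pullbackCore (F : X →L[𝕜] X) F.injective,
      isEquivalentScalarProduct_pullbackCore _ _ F.isEquivalentToNorm,
      isDissipative_pullbackCore_of_diniDeriv_normSq_nonpos hA _ _ fun x => ?_⟩
    have h1 := hV.diniDeriv_nonpos x
    rwa [funext hF] at h1
  tfae_have 3 → 4 := fun ⟨S, hS, hd, _⟩ => ⟨S, hS, hd⟩
  tfae_have 4 → 5 := fun ⟨_, hS, hd⟩ => hS.isSimilarToContraction hA hT hd
  tfae_have 5 → 1 := by
    intro h
    obtain ⟨G, hG⟩ := h.exists_normSq_decay hT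
    obtain ⟨c, C, hc, hC, hcC⟩ := G.isEquivalentToNorm
    refine ⟨fun x => ‖G x‖ ^ 2, isLpISSLyapunov_two_normSq hT B (G : X →L[𝕜] X) G.injective hG,
      ⟨(G : X →L[𝕜] X), G.injective, fun x => rfl⟩, c ^ 2, C ^ 2, by positivity, by positivity,
      fun x => ?_⟩
    rw [← mul_pow, ← mul_pow]
    exact ⟨pow_le_pow_left₀ (by positivity) (hcC x).1 2,
      pow_le_pow_left₀ (norm_nonneg _) (hcC x).2 2⟩
  tfae_have 5 → 3 := by
    intro h
    obtain ⟨G, hG⟩ := h.exists_normSq_decay hT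
    refine ⟨pullbackCore (G : X →L[𝕜] X) G.injective,
      isEquivalentScalarProduct_pullbackCore _ _ G.isEquivalentToNorm,
      isDissipative_pullbackCore_of_diniDeriv_normSq_nonpos hA _ _ fun x => ?_, ?_, ?_⟩
    · exact (isISSLyapunov_normSq hT (0 : U →L[𝕜] X) (G : X →L[𝕜] X) G.injective
        hG).diniDeriv_nonpos x
    · rw [scalarNormSq_pullbackCore (G : X →L[𝕜] X) G.injective]
      exact isISSLyapunov_normSq hT B (G : X →L[𝕜] X) G.injective hG
    · rw [scalarNormSq_pullbackCore (G : X →L[𝕜] X) G.injective]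
      exact isQuadratic_normSq _
  tfae_have 5 → 6 := by
    intro h
    obtain ⟨G, hG⟩ := h.exists_normSq_decay hT
    obtain ⟨a, ha, h⟩ := exists_diniDeriv_norm_le hT (G : X →L[𝕜] X) G.injective hG
    refine ⟨G, G.isEquivalentToNorm, a, ha, fun x => ?_⟩
    rw [mildSolution_zero_operator]
    exact h x
  tfae_have 6 → 4 := by
    rintro ⟨F, hF, a, ha, h⟩
    -- Here `F` need not be onto; the lower norm bound makes it injective, which is all that the
    -- pull-back scalar product requires.
    have hinj : Function.Injective F := by
      obtain ⟨c, C, hc, -, hcC⟩ := hF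
      refine (injective_iff_map_eq_zero F).2 fun x hx => norm_eq_zero.1 ?_
      have h1 := (hcC x).1
      simp only [hx, norm_zero] at h1
      nlinarith [norm_nonneg x]
    refine ⟨pullbackCore F hinj, isEquivalentScalarProduct_pullbackCore F hinj hF,
      isDissipative_pullbackCore_of_diniDeriv_norm_nonpos hA F hinj fun x => ?_⟩
    have h1 := h x
    rw [mildSolution_zero_operator] at h1
    refine h1.trans ?_
    have : -a * ‖F x‖ ≤ 0 := by nlinarith [norm_nonneg (F x)]
    exact_mod_cast this
  tfae_finish
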